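/- **Setting.** Let $0<\alpha<1$ and let $\Gamma=(\Gamma(1),\dots,\Gamma(d)):\mathbb{R}\to\mathbb{R}^d$ be a compactly supported $\alpha$-Hölder path. For a word $w=(w_1,\dots,w_n)\in\{1,\dots,d\}^n$ let $\mu_w:=d\Gamma(w_1)\otimes\cdots\otimes d\Gamma(w_n)$, a tempered distribution on $\mathbb{R}^n$ with Fourier transform $\prod_j i\xi_j(\mathcal{F}\Gamma(w_j))(\xi_j)$, where $\mathcal{F}f(\xi)=(2\pi)^{-1/2}\int f(x)e^{-ix\xi}dx$. All distributions below have functions as Fourier transforms and are identified with these functions. *Forests.* $\mathcal{F}^+_{n,n}$ is the set of rooted forests with vertex set $\{1,\dots,n\}$ in which every vertex is larger than the vertex directly below it, and $\mathbf{H}^+_{n,n}$ is the real vector space with basis $\mathcal{F}^+_{n,n}$. For $T_i\in\mathcal{F}^+_{n_i,n_i}$ ($i=1,2$), $T_1\wedge T_2\in\mathcal{F}^+_{n_1+n_2,n_1+n_2}$ is the disjoint union, the vertices of $T_2$ being shifted by $n_1$. *Permutation graphs.* For a permutation $\sigma\in\Sigma_n$ and $1\le j\le n$ let $u_j<j$ be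 the index for which $\sigma(u_j)$ is the largest element of $\{\sigma(i): i<j,\ \sigma(i)<\sigma(j)\}$, and let $l_j<j$ be the index for which $\sigma(l_j)$ is the smallest element of $\{\sigma(i): i<j,\ \sigma(i)>\sigma(j)\}$ (undefined if the set is empty). Then $$T^\sigma:=\sum_{S}(-1)^{|S|}\,T^\sigma_S\in\mathbf{H}^+_{n,n},$$ where $S$ ranges over the sets of indices $j$ for which $l_j$ exists, and $T^\sigma_S$ is the forest in which the vertex directly below $j$ is $l_j$ if $j\in S$, and $u_j$ if $j\notin S$ ($j$ is a root if $j\notin S$ and $u_j$ does not exist). *Measure splitting.* Let $(\tilde\phi_k)_{k\in\mathbb{Z}}$ be the indicator functions of the intervals $[-1,1]$ ($k=0$), $(2^{k-1},2^k]$ ($k\ge1$), $[-2^{|k|},-2^{|k|-1})$ ($k\le-1$). For $\vec k\in\mathbb{Z}^n$ let $\tilde{\mathcal{P}}^{\{\vec k\}}$ be the Fourier multiplier $|\Sigma_{\vec k}|^{-1}\prod_j\tilde\phi_{k_j}(\xi_j)$, where $\Sigma_{\vec k}:=\{\tau\in\Sigma_n:\ |k_{\tau(j)}|=|k_j|\ \forall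 j\}$. For $\tau\in\Sigma_n$ put $$\tilde{\mathcal{P}}^{\tau}:=\sum_{|k_{\tau(1)}|\le\dots\le|k_{\tau(n)}|}\tilde{\mathcal{P}}^{\{\vec k\}},\qquad \mu^\tau:=(\tilde{\mathcal{P}}^{\tau}\mu)\circ\tau ,$$ where $\mu\circ\tau$ denotes the distribution $\mu$ with its $\tau(j)$-th coordinate renamed $j$-th coordinate, for every $j$ (so $(\otimes_j\mu_j)\circ\tau=\otimes_j\mu_{\tau(j)}$). *Linear forms.* For $T\in\mathcal{F}^+_{n,n}$ let $\mathcal{D}_T$ be the real vector space spanned by all $\tilde{\mathcal{P}}^{\tau}\mu_w$ with $w\in\{1,\dots,d\}^n$ and $\tau\in\Sigma_n$ such that the total ordering $\tau(1)<\dots<\tau(n)$ is compatible with $T$ (every vertex comes after the vertex directly below it). For every $t\in\mathbb{R}$, $n\ge1$ and $T\in\mathcal{F}^+_{n,n}$ let $\phi^t_T:\mathcal{D}_T\to\mathbb{R}$ be a linear form; write $\phi^t_\mu(T):=\phi^t_T(\mu)$. Assume that 1. ($\mathbf{H}$-multiplicativity) $\phi^t_{\mu_1}(T_1)\,\phi^t_{\mu_2}(T_2)=\phi^t_{\mu_1\otimes\mu_2}(T_1\wedge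 T_2)$ for $T_i\in\mathcal{F}^+_{n_i,n_i}$, $\mu_i\in\mathcal{D}_{T_i}$, $n_i\ge1$; 2. (invariance under relabelling) $\phi^t_T(\mu)$ does not change when the vertices of $T$, together with the corresponding coordinates of $\mu$, are relabelled by a permutation which preserves the order of the vertices inside each tree of $T$ and which turns $T$ into an element of $\mathcal{F}^+_{n,n}$. *Shuffle algebra.* $\mathbf{Sh}^d$ is the real vector space whose basis consists of the trunk trees decorated by $\{1,\dots,d\}$, i.e. of the words $w$ (listed from the root upwards), the empty word being the unit $e$, with the shuffle product $w'\pitchfork w''$ = sum, with multiplicities, of all shuffles of $w'$ and $w''$. **Lemma 3.5.** For every $t\in\mathbb{R}$, the linear form $\bar\chi^t_\Gamma:\mathbf{Sh}^d\to\mathbb{R}$ defined by $\bar\chi^t_\Gamma(e)=1$ and $$\bar\chi^t_\Gamma(w):=\sum_{\sigma\in\Sigma_n}\phi^t_{\mu_w^\sigma}(T^\sigma)\qquad(w\in\{1,\dots,d\}^n,\ n\ge1),$$ where $\phi^t_{\mu_w^\sigma}$ is extended linearly to $\mathbf{H}^+_{n,n}$, is a character of $\mathbf{Sh}^d$: $\bar\chi^t_\Gamma(x\pitchfork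 y)=\bar\chi^t_\Gamma(x)\,\bar\chi^t_\Gamma(y)$ for all $x,y\in\mathbf{Sh}^d$. -/

import Mathlib

open scoped NNReal

noncomputable section

namespace FourierNormalOrdering

/-! ### Heap-ordered forests

A forest with `n` vertices and a bijective decoration by `{1, …, n}` such that decorations increase
away from the roots has no nontrivial automorphism, so it is the same thing as a parent function on
`Fin n` for which every parent is smaller than its child.  `parent j = none` means that `j` is a
root, and `parent j = some i` means that `j` connects directly to `i`. -/

/-- The set `𝓕⁺_{n,n}` of forests with vertices decorated bijectively by `Fin n`, the decoration
being compatible with the tree partial ordering. -/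
@[ext]
structure IncForest (n : ℕ) where
  /-- the vertex directly below a vertex, if there is one -/
  parent : Fin n → Option (Fin n)
  parent_lt : ∀ j i, parent j = some i → i < j

namespace IncForest

/-- Two vertices lie in the same tree of the forest. -/
def SameTree {n : ℕ} (T : IncForest n) : Fin n → Fin n → Prop :=
  Relation.EqvGen fun j i => T.parent j = some i

/-- `T₁ ∧ T₂`: the forest `T₁ . T₂`, the decoration of `T₂` being shifted by `n₁`. -/
def wedge {n₁ n₂ : ℕ} (T₁ : IncForest n₁) (T₂ : IncForest n₂) : IncForest (n₁ + n₂) where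
  parent := Fin.addCases (fun j => (T₁.parent j).map (Fin.castAdd n₂))
    (fun j => (T₂.parent j).map (Fin.natAdd n₁))
  parent_lt := by
    intro j i
    refine Fin.addCases (fun j => ?_) (fun j => ?_) j
    · simp only [Fin.addCases_left, Option.map_eq_some_iff]
      rintro ⟨a, ha, rfl⟩
      exact Fin.lt_def.2 (Fin.lt_def.1 (T₁.parent_lt j a ha))
    · simp only [Fin.addCases_right, Option.map_eq_some_iff]
      rintro ⟨a, ha, rfl⟩
      exact Fin.lt_def.2 (Nat.add_lt_add_left (Fin.lt_def.1 (T₂.parent_lt j a ha)) n₁)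

/-- The permutation `e` of the vertex decorations turns the forest `T` into the forest `T'`. -/
def IsRelabelling {n : ℕ} (e : Equiv.Perm (Fin n)) (T T' : IncForest n) : Prop :=
  ∀ j, T'.parent (e j) = (T.parent j).map e

end IncForest

/-! ### Permutation graphs

Integrate over the simplex `t ≥ x₁ ≥ … ≥ x_n ≥ s` in the order `x_{σ(1)}, x_{σ(2)}, …`.  When
`x_{σ(j)}` is integrated, its upper bound is `x_b` for the largest `b < σ(j)` already met (or `t`),
and its lower bound is `x_a` for the smallest `a > σ(j)` already met (or `s`).  A lower bound `x_a`
is removed by `∫_{x_a}^{τ} = ∫_s^{τ} - ∫_s^{x_a}`.  Expanding, every term is a forest on the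
renamed vertices `1, …, n`, where the vertex `j` stands for `σ(j)`. -/

/-- The vertex `i < j` which carries the upper bound for the vertex `j`; `none` if it is `t`. -/
def upperVertex {n : ℕ} (σ : Equiv.Perm (Fin n)) (j : Fin n) : Option (Fin n) :=
  if h : (Finset.univ.filter fun b : Fin n => b < σ j ∧ σ.symm b < j).Nonempty then
    some (σ.symm ((Finset.univ.filter fun b : Fin n => b < σ j ∧ σ.symm b < j).max' h))
  else none

/-- The vertex `i < j` which carries the lower bound for the vertex `j`; `none` if it is `s`. -/
def lowerVertex {n : ℕ} (σ : Equiv.Perm (Fin n)) (j : Fin n) : Option (Fin n) :=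
  if h : (Finset.univ.filter fun a : Fin n => σ j < a ∧ σ.symm a < j).Nonempty then
    some (σ.symm ((Finset.univ.filter fun a : Fin n => σ j < a ∧ σ.symm a < j).min' h))
  else none

theorem upperVertex_lt {n : ℕ} (σ : Equiv.Perm (Fin n)) (j i : Fin n)
    (h : upperVertex σ j = some i) : i < j := by
  unfold upperVertex at h
  split_ifs at h with hne
  have hm := Finset.max'_mem _ hne
  rw [Finset.mem_filter] at hm
  rw [← Option.some.inj h]
  exact hm.2.2

theorem lowerVertex_lt {n : ℕ} (σ : Equiv.Perm (Fin n)) (j i : Fin n)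
    (h : lowerVertex σ j = some i) : i < j := by
  unfold lowerVertex at h
  split_ifs at h with hne
  have hm := Finset.min'_mem _ hne
  rw [Finset.mem_filter] at hm
  rw [← Option.some.inj h]
  exact hm.2.2

/-- The forest obtained by choosing the lower bound for the vertices in `S`, and the upper bound
for the other ones. -/
def permForest {n : ℕ} (σ : Equiv.Perm (Fin n)) (S : Finset (Fin n)) : IncForest n where
  parent j := if j ∈ S then lowerVertex σ j else upperVertex σ j
  parent_lt := by
    intro j i h
    split_ifs at h
    · exact lowerVertex_lt σ j i h
    · exact upperVertex_lt σ j i h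

/-- The permutation graph `T^σ`, an element of the real vector space `H⁺_{n,n}` spanned by
`𝓕⁺_{n,n}`: each choice of a lower bound, possible where that bound is not `s`, gives a sign. -/
def permGraph {n : ℕ} (σ : Equiv.Perm (Fin n)) : IncForest n →₀ ℝ :=
  ∑ S ∈ (Finset.univ.filter fun j => (lowerVertex σ j).isSome).powerset,
    Finsupp.single (permForest σ S) ((-1 : ℝ) ^ S.card)

/-! ### Distributions on the Fourier side

All the (generalized) measures below are tempered distributions on `ℝⁿ` whose Fourier transform is
a function.  Such a distribution is represented by its Fourier transform, with the unitary
normalization `(2π)^{-n/2}`.  The Fourier multiplier `D(m)` is then multiplication by `m`, the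
tensor product is the tensor product of functions, and a permutation of the coordinates acts in the
same way on both sides. -/

/-- Fourier transforms of (generalized) measures on `ℝⁿ`. -/
abbrev FourierSide (n : ℕ) : Type := (Fin n → ℝ) → ℂ

/-- `(𝓕 f)(ξ) = (2π)^{-1/2} ∫ f(x) e^{-i x ξ} dx`. -/
def fourierR (f : ℝ → ℝ) (ξ : ℝ) : ℂ :=
  ((Real.sqrt (2 * Real.pi) : ℝ) : ℂ)⁻¹ *
    ∫ x : ℝ, (f x : ℂ) * Complex.exp (-(Complex.I * x * ξ))

/-- The Fourier transform `iξ (𝓕 f)(ξ)` of the distribution `df`. -/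
def fourierD (f : ℝ → ℝ) (ξ : ℝ) : ℂ := Complex.I * ξ * fourierR f ξ

/-- The generalized measure `⊗_j dΓ(ℓ(j))`. -/
def pathMeasure {d n : ℕ} (Γ : ℝ → EuclideanSpace ℝ (Fin d)) (w : Fin n → Fin d) :
    FourierSide n :=
  fun ξ => ∏ j, fourierD (fun x => Γ x (w j)) (ξ j)

/-- `μ₁ ⊗ μ₂`. -/
def tensor {n₁ n₂ : ℕ} (μ₁ : FourierSide n₁) (μ₂ : FourierSide n₂) : FourierSide (n₁ + n₂) :=
  fun ξ => μ₁ (fun j => ξ (Fin.castAdd n₂ j)) * μ₂ (fun j => ξ (Fin.natAdd n₁ j))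

/-- `μ ∘ σ`: the `j`-th coordinate of the new measure is the `σ(j)`-th coordinate of `μ`, so that
`(⊗_j μ_j) ∘ σ = ⊗_j μ_{σ(j)}`. -/
def permute {n : ℕ} (σ : Equiv.Perm (Fin n)) (μ : FourierSide n) : FourierSide n :=
  fun η => μ fun i => η (σ.symm i)

/-- The dyadic shells: `[-1, 1]` for `k = 0`, `(2^{k-1}, 2^k]` for `k ≥ 1`, and the mirror image of
the shell of `-k` for `k ≤ -1`.  Only one endpoint is kept, so that the shells form a partition. -/
def shell (k : ℤ) : Set ℝ :=
  if k = 0 then Set.Icc (-1) 1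
  else if 0 < k then Set.Ioc ((2 : ℝ) ^ (k - 1)) ((2 : ℝ) ^ k)
  else Set.Ico (-(2 : ℝ) ^ (-k)) (-(2 : ℝ) ^ (-k - 1))

/-- The sharp dyadic partition of unity `φ̃_k`. -/
def phiTilde (k : ℤ) : ℝ → ℝ := (shell k).indicator 1

/-- `|Σ_k|`, the number of permutations `τ` such that `|k_{τ(j)}| = |k_j|` for every `j`. -/
def sigmaCard {n : ℕ} (k : Fin n → ℤ) : ℕ :=
  Nat.card {τ : Equiv.Perm (Fin n) // ∀ j, |k (τ j)| = |k j|}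

open Classical in
/-- The multiplier of the Fourier normal ordered projection
`∑_{|k_{τ(1)}| ≤ … ≤ |k_{τ(n)}|} (1 / |Σ_k|) ⊗_v D(φ̃_{k_v})`
attached to the total ordering `τ(1) < … < τ(n)` of the coordinates.  In each point at most one
multi-index `k` contributes. -/
def orderMultiplier {n : ℕ} (τ : Equiv.Perm (Fin n)) (ξ : Fin n → ℝ) : ℝ :=
  ∑ᶠ k : Fin n → ℤ,
    if Monotone (fun j => |k (τ j)|) then (sigmaCard k : ℝ)⁻¹ * ∏ v, phiTilde (k v) (ξ v) else 0

/-- The projection of `μ` attached to the total ordering `τ(1) < … < τ(n)`. -/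
def orderProj {n : ℕ} (τ : Equiv.Perm (Fin n)) (μ : FourierSide n) : FourierSide n :=
  fun ξ => (orderMultiplier τ ξ : ℂ) * μ ξ

/-- The component `μ^σ = ∑_{|k_{σ(1)}| ≤ … ≤ |k_{σ(n)}|} (P̃^{k} μ) ∘ σ` of the splitting of `μ`. -/
def splitMeasure {n : ℕ} (σ : Equiv.Perm (Fin n)) (μ : FourierSide n) : FourierSide n :=
  permute σ (orderProj σ μ)

/-- The total ordering `τ(1) < … < τ(n)` is compatible with the tree ordering of `T`. -/
def CompatibleOrder {n : ℕ} (T : IncForest n) (τ : Equiv.Perm (Fin n)) : Prop :=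
  ∀ j i, T.parent j = some i → τ.symm i < τ.symm j

/-- The real vector space of Fourier normal ordered generalized measures for the forest `T` built
from the path `Γ`: it is spanned by the projections of the measures `⊗_j dΓ(w(j))` attached to the
total orderings that are compatible with `T`. -/
def orderedMeasures {d n : ℕ} (Γ : ℝ → EuclideanSpace ℝ (Fin d)) (T : IncForest n) :
    Submodule ℝ (FourierSide n) :=
  Submodule.span ℝ {ν | ∃ (τ : Equiv.Perm (Fin n)) (w : Fin n → Fin d),
    CompatibleOrder T τ ∧ ν = orderProj τ (pathMeasure Γ w)}

/-! ### The components of the splitting are Fourier normal ordered -/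

theorem sigmaCard_comp {n : ℕ} (σ : Equiv.Perm (Fin n)) (k : Fin n → ℤ) :
    sigmaCard (fun j => k (σ j)) = sigmaCard k := by
  refine Nat.card_congr (Equiv.subtypeEquiv (Equiv.permCongr σ) fun τ => ?_)
  constructor
  · intro h j
    simpa [Equiv.permCongr_apply] using h (σ.symm j)
  · intro h j
    simpa [Equiv.permCongr_apply] using h (σ j)

theorem orderMultiplier_comp {n : ℕ} (σ : Equiv.Perm (Fin n)) (η : Fin n → ℝ) :
    orderMultiplier σ (fun i => η (σ.symm i)) = orderMultiplier 1 η := by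
  classical
  unfold orderMultiplier
  refine finsum_eq_of_bijective (fun k => fun j => k (σ j)) ?_ fun k => ?_
  · exact (Equiv.arrowCongr σ.symm (Equiv.refl ℤ)).bijective
  · have h : ∏ v, phiTilde (k v) (η (σ.symm v)) = ∏ v, phiTilde (k (σ v)) (η v) := by
      rw [← Equiv.prod_comp σ]
      simp
    simp only [h, sigmaCard_comp, Equiv.Perm.coe_one, id]

theorem splitMeasure_pathMeasure {d n : ℕ} (Γ : ℝ → EuclideanSpace ℝ (Fin d))
    (σ : Equiv.Perm (Fin n)) (w : Fin n → Fin d) :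
    splitMeasure σ (pathMeasure Γ w) = orderProj 1 (pathMeasure Γ fun j => w (σ j)) := by
  funext η
  simp only [splitMeasure, permute, orderProj, orderMultiplier_comp]
  congr 1
  unfold pathMeasure
  rw [← Equiv.prod_comp σ]
  simp

theorem splitMeasure_mem {d n : ℕ} (Γ : ℝ → EuclideanSpace ℝ (Fin d)) (T : IncForest n)
    (σ : Equiv.Perm (Fin n)) (w : Fin n → Fin d) :
    splitMeasure σ (pathMeasure Γ w) ∈ orderedMeasures Γ T := by
  rw [splitMeasure_pathMeasure]
  refine Submodule.subset_span ⟨1, _, ?_, rfl⟩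
  intro j i h
  exact T.parent_lt j i h

/-! ### Multiplicative families of linear forms -/

/-- Families `(φ_T)` of real linear forms, `φ_T` being defined on the Fourier normal ordered
generalized measures for the forest `T`. -/
abbrev FormFamily {d : ℕ} (Γ : ℝ → EuclideanSpace ℝ (Fin d)) : Type :=
  ∀ (n : ℕ) (T : IncForest n), orderedMeasures Γ T →ₗ[ℝ] ℝ

/-- The `H`-multiplicative property `φ_{μ₁}(T₁) φ_{μ₂}(T₂) = φ_{μ₁ ⊗ μ₂}(T₁ ∧ T₂)`. -/
def IsHMultiplicative {d : ℕ} {Γ : ℝ → EuclideanSpace ℝ (Fin d)} (φ : FormFamily Γ) : Prop :=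
  ∀ (n₁ n₂ : ℕ), 1 ≤ n₁ → 1 ≤ n₂ → ∀ (T₁ : IncForest n₁) (T₂ : IncForest n₂)
    (μ₁ : orderedMeasures Γ T₁) (μ₂ : orderedMeasures Γ T₂)
    (ν : orderedMeasures Γ (T₁.wedge T₂)),
    (ν : FourierSide (n₁ + n₂)) = tensor (μ₁ : FourierSide n₁) (μ₂ : FourierSide n₂) →
      φ n₁ T₁ μ₁ * φ n₂ T₂ μ₂ = φ (n₁ + n₂) (T₁.wedge T₂) ν

/-- `φ_T(μ)` depends only on the forest `T`, on the measure `μ` on `ℝ^{V(T)}`, and on the ordering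
of the vertices of each tree of `T`: it does not change when the vertices of `T`, together with the
coordinates of `μ`, are relabelled in such a way that the order inside each tree is preserved. -/
def IsRelabellingInvariant {d : ℕ} {Γ : ℝ → EuclideanSpace ℝ (Fin d)} (φ : FormFamily Γ) : Prop :=
  ∀ (n : ℕ) (T T' : IncForest n) (e : Equiv.Perm (Fin n)), IncForest.IsRelabelling e T T' →
    (∀ i j, T.SameTree i j → i < j → e i < e j) →
    ∀ (μ : orderedMeasures Γ T) (μ' : orderedMeasures Γ T'),
      (μ' : FourierSide n) = permute e.symm (μ : FourierSide n) → φ n T' μ' = φ n T μ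

/-! ### The shuffle algebra -/

/-- Trunk trees with decorations in `Fin d`, the vertices being listed from the root upwards; the
word of length `0` is the unit `e`. -/
abbrev Word (d : ℕ) : Type := Σ n : ℕ, (Fin n → Fin d)

/-- The vector space `Sh^d`. -/
abbrev Sh (d : ℕ) : Type := Word d →₀ ℝ

/-- Shuffles of `(1, …, n₁)` and `(n₁ + 1, …, n₁ + n₂)`; `ε i` is the new position of `i`. -/
def IsShuffle (n₁ n₂ : ℕ) (ε : Equiv.Perm (Fin (n₁ + n₂))) : Prop :=
  StrictMono (fun i : Fin n₁ => ε (Fin.castAdd n₂ i)) ∧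
    StrictMono (fun i : Fin n₂ => ε (Fin.natAdd n₁ i))

open Classical in
/-- The shuffle product of two words, with multiplicities. -/
def shuffleWords {d : ℕ} (u v : Word d) : Sh d :=
  ∑ ε : Equiv.Perm (Fin (u.1 + v.1)) with IsShuffle u.1 v.1 ε,
    Finsupp.single (⟨u.1 + v.1, fun j => Fin.append u.2 v.2 (ε.symm j)⟩ : Word d) 1

/-- The shuffle product on `Sh^d`, the bilinear extension of the shuffle product of words. -/
def shuffle {d : ℕ} (x y : Sh d) : Sh d :=
  x.sum fun u a => y.sum fun v b => (a * b) • shuffleWords u v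

/-- The unit `e` of the shuffle algebra. -/
def shUnit (d : ℕ) : Sh d := Finsupp.single ⟨0, Fin.elim0⟩ 1

/-- Characters of the shuffle algebra: unital multiplicative linear forms. -/
def IsCharacter {d : ℕ} (χ : Sh d →ₗ[ℝ] ℝ) : Prop :=
  χ (shUnit d) = 1 ∧ ∀ x y : Sh d, χ (shuffle x y) = χ x * χ y

/-! ### The linear form -/

/-- `φ_{μ^σ}(T^σ)` for `μ = ⊗_j dΓ(w(j))`, where `T ↦ φ_{μ^σ}(T)` is extended linearly from
`𝓕⁺_{n,n}` to `H⁺_{n,n}`. -/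
def formOnGraph {d n : ℕ} {Γ : ℝ → EuclideanSpace ℝ (Fin d)} (φ : FormFamily Γ)
    (w : Fin n → Fin d) (σ : Equiv.Perm (Fin n)) : ℝ :=
  (permGraph σ).sum fun T a =>
    a * φ n T ⟨splitMeasure σ (pathMeasure Γ w), splitMeasure_mem Γ T σ w⟩

/-- The value of `χ̄` on a word: `1` on the empty word, and `∑_σ φ_{μ^σ}(T^σ)` otherwise. -/
def chiBarWord {d : ℕ} {Γ : ℝ → EuclideanSpace ℝ (Fin d)} (φ : FormFamily Γ) (u : Word d) : ℝ :=
  if u.1 = 0 then 1 else ∑ σ : Equiv.Perm (Fin u.1), formOnGraph φ u.2 σ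

/-- The linear form `χ̄` on `Sh^d`. -/
def chiBar {d : ℕ} {Γ : ℝ → EuclideanSpace ℝ (Fin d)} (φ : FormFamily Γ) : Sh d →ₗ[ℝ] ℝ :=
  Finsupp.linearCombination ℝ (chiBarWord φ)

end FourierNormalOrdering

end

noncomputable section

namespace FourierNormalOrdering

/-! ### Order indicators of forests -/

/-! Two splittings meet. On the combinatorial side, evaluate a forest on a total ordering of its
vertices, giving 1 if the ordering increases away from the roots and 0 otherwise. The alternating
sum `permGraph σ` then becomes the delta function at the ordering `σ` (`indicatorMap_permGraph`).
Since there are at most n! increasing forests, a combination of forests is determined by these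
values (`indicatorMap_injective`). Hence identities between permutation graphs can be checked on
orderings; in particular, the product of two permutation graphs, relabelled by a shuffle `ε`, is the
sum of the `permGraph (η * blockPerm σ₁ σ₂ * ε⁻¹)` over all shuffles `η`
(`shuffleWedgeGraph_permGraph`).

On the Fourier side, a tensor product of two naturally ordered pieces splits into the pieces ordered
by `ε⁻¹`, with `ε` a shuffle (`tensor_orderProj_one`); the weight `1 / |Σ_k|` makes this exact when
frequencies tie. Multiplicativity and relabelling invariance turn it into a product formula for the
forms (`form_mul_form`).

Together they express the product of the two values as a sum over `(σ₁, σ₂, ε, η)`. Each permutation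
is uniquely `ρ = blockPerm σ₁ σ₂ * ε⁻¹`, and the substitution `σ = η * ρ` produces the sum defining
the value on the shuffle product (`sum_formOnGraph_mul`). -/

/-- The indicator of `x` being larger at `j` than at the vertex `o`, if there is one. -/
def belowIndicator {n : ℕ} {β : Type*} [LinearOrder β] (x : Fin n → β) (j : Fin n)
    (o : Option (Fin n)) : ℝ :=
  o.elim 1 fun i => if x i < x j then 1 else 0

/-- The indicator of `x` increasing away from the roots of `T`. -/
def IncForest.indicator {n : ℕ} {β : Type*} [LinearOrder β] (T : IncForest n) (x : Fin n → β) :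
    ℝ :=
  ∏ j, belowIndicator x j (T.parent j)

/-- The linear extension of `IncForest.indicator` to formal combinations of forests. -/
def indicatorForm {n : ℕ} {β : Type*} [LinearOrder β] (x : Fin n → β) :
    (IncForest n →₀ ℝ) →ₗ[ℝ] ℝ :=
  Finsupp.linearCombination ℝ fun T => T.indicator x

theorem indicatorForm_single {n : ℕ} {β : Type*} [LinearOrder β] (x : Fin n → β)
    (T : IncForest n) (a : ℝ) : indicatorForm x (Finsupp.single T a) = a * T.indicator x := by
  simp [indicatorForm]

theorem indicator_wedge {n₁ n₂ : ℕ} {β : Type*} [LinearOrder β] (T₁ : IncForest n₁)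
    (T₂ : IncForest n₂) (x : Fin (n₁ + n₂) → β) :
    (T₁.wedge T₂).indicator x =
      T₁.indicator (fun i => x (Fin.castAdd n₂ i)) *
        T₂.indicator (fun i => x (Fin.natAdd n₁ i)) := by
  unfold IncForest.indicator
  rw [Fin.prod_univ_add]
  congr 1 <;> refine Finset.prod_congr rfl fun j _ => ?_
  · cases h : T₁.parent j <;> simp [IncForest.wedge, belowIndicator, h]
  · cases h : T₂.parent j <;> simp [IncForest.wedge, belowIndicator, h]

theorem IncForest.IsRelabelling.indicator_eq {n : ℕ} {β : Type*} [LinearOrder β]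
    {e : Equiv.Perm (Fin n)} {T T' : IncForest n} (h : IncForest.IsRelabelling e T T')
    (x : Fin n → β) : T'.indicator x = T.indicator (fun i => x (e i)) := by
  unfold IncForest.indicator
  rw [← Equiv.prod_comp e]
  refine Finset.prod_congr rfl fun j _ => ?_
  rw [h j]
  cases T.parent j <;> simp [belowIndicator]

/-! ### The order indicator of a permutation graph -/

theorem upperVertex_eq_none {n : ℕ} {σ : Equiv.Perm (Fin n)} {j : Fin n}
    (h : upperVertex σ j = none) {i : Fin n} (hi : i < j) : ¬ σ i < σ j := by
  intro hlt
  unfold upperVertex at h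
  split_ifs at h with hne
  exact hne ⟨σ i, by simp [hlt, hi]⟩

theorem upperVertex_eq_some {n : ℕ} {σ : Equiv.Perm (Fin n)} {j u : Fin n}
    (h : upperVertex σ j = some u) :
    σ u < σ j ∧ ∀ i, i < j → σ i < σ j → σ i ≤ σ u := by
  unfold upperVertex at h
  split_ifs at h with hne
  have hm := Finset.max'_mem _ hne
  rw [Finset.mem_filter] at hm
  rw [← Option.some.inj h, Equiv.apply_symm_apply]
  exact ⟨hm.2.1, fun i hi hlt => Finset.le_max' _ _ (by simp [hlt, hi])⟩

theorem lowerVertex_eq_none {n : ℕ} {σ : Equiv.Perm (Fin n)} {j : Fin n}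
    (h : lowerVertex σ j = none) {i : Fin n} (hi : i < j) : ¬ σ j < σ i := by
  intro hlt
  unfold lowerVertex at h
  split_ifs at h with hne
  exact hne ⟨σ i, by simp [hlt, hi]⟩

theorem lowerVertex_eq_some {n : ℕ} {σ : Equiv.Perm (Fin n)} {j l : Fin n}
    (h : lowerVertex σ j = some l) :
    σ j < σ l ∧ ∀ i, i < j → σ j < σ i → σ l ≤ σ i := by
  unfold lowerVertex at h
  split_ifs at h with hne
  have hm := Finset.min'_mem _ hne
  rw [Finset.mem_filter] at hm
  rw [← Option.some.inj h, Equiv.apply_symm_apply]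
  exact ⟨hm.2.1, fun i hi hlt => Finset.min'_le _ _ (by simp [hlt, hi])⟩

/-- The signed contribution of the vertex `j` to the order indicator of `T^σ`. -/
def vertexFactor {n : ℕ} {β : Type*} [LinearOrder β] (σ : Equiv.Perm (Fin n)) (x : Fin n → β)
    (j : Fin n) : ℝ :=
  belowIndicator x j (upperVertex σ j) -
    if (lowerVertex σ j).isSome then belowIndicator x j (lowerVertex σ j) else 0

/-- Expanding the product of differences over subsets reproduces the signed sum over `S`. An absent
vertex has indicator 1, which is right for a missing upper bound; a missing lower bound must
contribute 0, whence the guard in `vertexFactor`. -/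
theorem indicatorForm_permGraph_eq_prod {n : ℕ} {β : Type*} [LinearOrder β]
    (σ : Equiv.Perm (Fin n)) (x : Fin n → β) :
    indicatorForm x (permGraph σ) = ∏ j, vertexFactor σ x j := by
  unfold vertexFactor
  rw [Finset.prod_sub, permGraph, map_sum]
  rw [← Finset.sum_subset (Finset.powerset_mono.2 (Finset.subset_univ
    (Finset.univ.filter fun j => (lowerVertex σ j).isSome)))]
  rotate_left
  · intro S _ hS
    rw [Finset.mem_powerset, Finset.not_subset] at hS
    obtain ⟨j, hj, hjn⟩ := hS
    rw [Finset.prod_eq_zero hj, mul_zero]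
    have hjn : lowerVertex σ j = none := by simpa using hjn
    simp [hjn]
  · refine Finset.sum_congr rfl fun S hS => ?_
    rw [indicatorForm_single, mul_assoc]
    congr 1
    unfold IncForest.indicator
    rw [← Finset.prod_sdiff (Finset.subset_univ S)]
    congr 1 <;> refine Finset.prod_congr rfl fun j hj => ?_
    · simp only [Finset.mem_sdiff] at hj
      simp [permForest, hj.2]
    · have h := Finset.mem_powerset.1 hS hj
      rw [Finset.mem_filter] at h
      simp [permForest, hj, h.2]

/-- `x` orders the vertices below `j` and `j` itself as `σ` does, as far as `j` is concerned. -/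
def AgreesAt {n : ℕ} {β : Type*} [LinearOrder β] (σ : Equiv.Perm (Fin n)) (x : Fin n → β)
    (j : Fin n) : Prop :=
  ∀ i, i < j → (σ i < σ j ↔ x i < x j)

/-- The larger of the two vertices decides: agreement there compares it with the smaller one, and
injectivity excludes ties. -/
theorem lt_iff_of_agreesAt {n : ℕ} {β : Type*} [LinearOrder β] {σ : Equiv.Perm (Fin n)}
    {x : Fin n → β} (hx : Function.Injective x) {j : Fin n}
    (h : ∀ i, i < j → AgreesAt σ x i) {a b : Fin n} (ha : a < j) (hb : b < j) :
    σ a < σ b ↔ x a < x b := by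
  rcases lt_trichotomy a b with hab | rfl | hab
  · exact h b hb a hab
  · simp
  · have h1 := h a ha b hab
    rw [← not_le, ← not_le, not_iff_not, le_iff_lt_or_eq, le_iff_lt_or_eq, h1]
    simp [hx.eq_iff]

-- The vertices `u` and `l` are the neighbours of `j` in the order of `σ` among the earlier
-- vertices, which `x` orders as `σ` does. So agreement at `j` only requires `x j` to lie between `x
-- u` and `x l`. As `x u < x l`, the difference of the two indicators is the indicator of that
-- interval.
open Classical in
theorem vertexFactor_eq {n : ℕ} {β : Type*} [LinearOrder β] (σ : Equiv.Perm (Fin n))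
    {x : Fin n → β} (hx : Function.Injective x) (j : Fin n)
    (h : ∀ i, i < j → AgreesAt σ x i) :
    vertexFactor σ x j = if AgreesAt σ x j then 1 else 0 := by
  have key : ∀ {a b : Fin n}, a < j → b < j → (σ a < σ b ↔ x a < x b) :=
    fun ha hb => lt_iff_of_agreesAt hx h ha hb
  have hcmp : ∀ {a b : Fin n}, a < j → b < j → σ a ≤ σ b → x a ≤ x b := fun ha hb hab =>
    not_lt.1 fun hlt => absurd ((key hb ha).2 hlt) (not_lt.2 hab)
  unfold vertexFactor
  cases hu : upperVertex σ j with
  | none =>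
    have hu' := fun i (hi : i < j) => upperVertex_eq_none hu hi
    cases hl : lowerVertex σ j with
    | none =>
      -- With neither neighbour there is no earlier vertex, and agreement is vacuous.
      have hA : AgreesAt σ x j := fun i hi => by
        have h1 := hu' i hi
        have h2 := lowerVertex_eq_none hl hi
        exact absurd (σ.injective (le_antisymm (not_lt.1 h2) (not_lt.1 h1))) hi.ne
      simp [belowIndicator, hA]
    | some l =>
      have hlj := lowerVertex_lt σ j l hl
      obtain ⟨hl1, hl2⟩ := lowerVertex_eq_some hl
      have hiff : AgreesAt σ x j ↔ ¬ x l < x j := by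
        constructor
        · intro hA hlt
          exact absurd ((hA l hlj).2 hlt) (not_lt.2 hl1.le)
        · intro hn i hi
          have h1 := hu' i hi
          have h2 : σ j < σ i := lt_of_le_of_ne (not_lt.1 h1)
            fun e => hi.ne (σ.injective e).symm
          have h3 := hcmp hlj hi (hl2 i hi h2)
          simp only [h1, false_iff]
          exact fun h4 => hn (h3.trans_lt h4)
      by_cases hc : x l < x j <;> simp [belowIndicator, hiff, hc]
  | some u =>
    have huj := upperVertex_lt σ j u hu
    obtain ⟨hu1, hu2⟩ := upperVertex_eq_some hu
    cases hl : lowerVertex σ j with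
    | none =>
      have hiff : AgreesAt σ x j ↔ x u < x j := by
        constructor
        · exact fun hA => (hA u huj).1 hu1
        · intro hlt i hi
          have h2 := lowerVertex_eq_none hl hi
          have h1 : σ i < σ j := lt_of_le_of_ne (not_lt.1 h2) fun e => hi.ne (σ.injective e)
          simp only [h1, true_iff]
          exact (hcmp hi huj (hu2 i hi h1)).trans_lt hlt
      by_cases hc : x u < x j <;> simp [belowIndicator, hiff, hc]
    | some l =>
      have hlj := lowerVertex_lt σ j l hl
      obtain ⟨hl1, hl2⟩ := lowerVertex_eq_some hl
      have hul : x u < x l := (key huj hlj).1 (hu1.trans hl1)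
      have hiff : AgreesAt σ x j ↔ x u < x j ∧ ¬ x l < x j := by
        constructor
        · exact fun hA => ⟨(hA u huj).1 hu1, fun hlt =>
            absurd ((hA l hlj).2 hlt) (not_lt.2 hl1.le)⟩
        · rintro ⟨hlt, hn⟩ i hi
          by_cases h1 : σ i < σ j
          · simp only [h1, true_iff]
            exact (hcmp hi huj (hu2 i hi h1)).trans_lt hlt
          · have h2 : σ j < σ i := lt_of_le_of_ne (not_lt.1 h1)
              fun e => hi.ne (σ.injective e).symm
            simp only [h1, false_iff]
            exact fun h4 => hn ((hcmp hlj hi (hl2 i hi h2)).trans_lt h4)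
      by_cases hc : x l < x j
      · simp [belowIndicator, hiff, hc, hul.trans hc]
      · by_cases hc' : x u < x j <;> simp [belowIndicator, hiff, hc, hc']

open Classical in
theorem indicatorForm_permGraph {n : ℕ} {β : Type*} [LinearOrder β] (σ : Equiv.Perm (Fin n))
    {x : Fin n → β} (hx : Function.Injective x) :
    indicatorForm x (permGraph σ) = if ∀ i j, σ i < σ j → x i < x j then 1 else 0 := by
  rw [indicatorForm_permGraph_eq_prod]
  split_ifs with h
  · have hA : ∀ j, AgreesAt σ x j := fun j i hi => by
      refine ⟨h i j, fun hlt => ?_⟩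
      by_contra hn
      exact absurd (h j i (lt_of_le_of_ne (not_lt.1 hn) fun e => hi.ne (σ.injective e).symm))
        (not_lt.2 hlt.le)
    refine Finset.prod_eq_one fun j _ => ?_
    rw [vertexFactor_eq σ hx j fun i _ => hA i, if_pos (hA j)]
  · have hex : ∃ j, ¬ AgreesAt σ x j := by
      by_contra! hA
      refine h fun i j hij => ?_
      rcases lt_trichotomy i j with hlt | rfl | hlt
      · exact (hA j i hlt).1 hij
      · exact absurd hij (lt_irrefl _)
      · exact (not_lt.1 fun hn => absurd ((hA i j hlt).2 hn) (not_lt.2 hij.le)).lt_of_ne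
          fun e => hlt.ne (hx e).symm
    -- At the first disagreement all earlier vertices agree, so the factor there is known, and it is
    -- 0.
    obtain ⟨j, hj, hmin⟩ := WellFounded.has_min (wellFounded_lt (α := Fin n))
      {j | ¬ AgreesAt σ x j} hex
    refine Finset.prod_eq_zero (Finset.mem_univ j) ?_
    rw [vertexFactor_eq σ hx j fun i hi => not_not.1 fun hn => hmin i hn hi, if_neg hj]

/-! ### Formal combinations of forests are determined by their order indicators -/

theorem perm_eq_one_of_strictMono {n : ℕ} {τ : Equiv.Perm (Fin n)} (h : StrictMono τ) :
    τ = 1 := by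
  have := Tuple.unique_monotone (f := id) (σ := τ) (τ := 1) h.monotone monotone_id
  exact Equiv.ext fun i => congrFun this i

theorem perm_eq_of_lt_imp {n : ℕ} {σ π : Equiv.Perm (Fin n)}
    (h : ∀ i j, σ i < σ j → π i < π j) : π = σ := by
  have : StrictMono (π * σ⁻¹) := fun a b hab => h _ _ (by simpa using hab)
  exact mul_inv_eq_one.1 (perm_eq_one_of_strictMono this)

/-- The order indicators with respect to all total orderings of the vertices. -/
def indicatorMap (n : ℕ) : (IncForest n →₀ ℝ) →ₗ[ℝ] (Equiv.Perm (Fin n) → ℝ) :=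
  LinearMap.pi fun π => indicatorForm π

theorem indicatorMap_permGraph {n : ℕ} (σ : Equiv.Perm (Fin n)) :
    indicatorMap n (permGraph σ) = Pi.single σ 1 := by
  classical
  funext π
  change indicatorForm π (permGraph σ) = _
  rw [indicatorForm_permGraph σ π.injective, Pi.single_apply]
  congr 1
  exact propext ⟨perm_eq_of_lt_imp, by rintro rfl; exact fun _ _ h => h⟩

theorem indicatorMap_surjective (n : ℕ) : Function.Surjective (indicatorMap n) := by
  classical
  intro f
  refine ⟨∑ σ, f σ • permGraph σ, ?_⟩
  simp only [map_sum, map_smul, indicatorMap_permGraph]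
  funext π
  simp [Finset.sum_apply, Pi.single_apply]

/-- The code of a forest: `0` for a root, and the successor of the parent otherwise. -/
def IncForest.code {n : ℕ} (T : IncForest n) (j : Fin n) : Fin (j.val + 1) :=
  match h : T.parent j with
  | none => 0
  | some i => ⟨i.val + 1, Nat.succ_lt_succ (T.parent_lt j i h)⟩

theorem IncForest.code_val {n : ℕ} (T : IncForest n) (j : Fin n) :
    (T.code j).val = (T.parent j).elim 0 fun i => i.val + 1 := by
  unfold IncForest.code
  split <;> rename_i h <;> simp [h]

theorem IncForest.code_injective (n : ℕ) :
    Function.Injective (IncForest.code : IncForest n → ∀ j : Fin n, Fin (j.val + 1)) := by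
  intro T T' h
  refine IncForest.ext (funext fun j => ?_)
  have hj := congrArg Fin.val (congrFun h j)
  rw [IncForest.code_val, IncForest.code_val] at hj
  cases h1 : T.parent j <;> cases h2 : T'.parent j <;> simp_all [Fin.ext_iff]

instance (n : ℕ) : Finite (IncForest n) := Finite.of_injective _ (IncForest.code_injective n)

/-- Counting from 0, the vertex `j` has at most `j + 1` choices: root, or one of `j` parents. So the
source has dimension at most n!, and the map is onto a space of dimension n!. -/
theorem indicatorMap_injective (n : ℕ) : Function.Injective (indicatorMap n) := by
  classical
  have := Fintype.ofFinite (IncForest n)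
  have hcard : Fintype.card (IncForest n) ≤ Fintype.card (Equiv.Perm (Fin n)) := by
    refine (Fintype.card_le_of_injective _ (IncForest.code_injective n)).trans ?_
    rw [Fintype.card_pi, Fintype.card_perm, Fintype.card_fin]
    simp only [Fintype.card_fin]
    rw [Fin.prod_univ_eq_prod_range (fun j => j + 1), Finset.prod_range_add_one_eq_factorial]
  refine (LinearMap.injective_iff_surjective_of_finrank_eq_finrank ?_).2
    (indicatorMap_surjective n)
  refine le_antisymm ?_ (LinearMap.finrank_le_finrank_of_surjective (indicatorMap_surjective n))
  rwa [Module.finrank_finsupp_self, Module.finrank_fintype_fun_eq_card]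

/-! ### Block permutations and shuffles -/

/-- The shuffles of two blocks of lengths `n₁` and `n₂`. -/
abbrev Shuffle (n₁ n₂ : ℕ) : Type := {ε : Equiv.Perm (Fin (n₁ + n₂)) // IsShuffle n₁ n₂ ε}

instance (n₁ n₂ : ℕ) : Fintype (Shuffle n₁ n₂) := Fintype.ofFinite _

/-- The permutation acting as `s₁` on the first block and as `s₂` on the second one. -/
def blockPerm {n₁ n₂ : ℕ} (s₁ : Equiv.Perm (Fin n₁)) (s₂ : Equiv.Perm (Fin n₂)) :
    Equiv.Perm (Fin (n₁ + n₂)) :=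
  finSumFinEquiv.permCongr (Equiv.sumCongr s₁ s₂)

@[simp]
theorem blockPerm_castAdd {n₁ n₂ : ℕ} (s₁ : Equiv.Perm (Fin n₁)) (s₂ : Equiv.Perm (Fin n₂))
    (i : Fin n₁) : blockPerm s₁ s₂ (Fin.castAdd n₂ i) = Fin.castAdd n₂ (s₁ i) := by
  simp [blockPerm, Equiv.permCongr_apply]

@[simp]
theorem blockPerm_natAdd {n₁ n₂ : ℕ} (s₁ : Equiv.Perm (Fin n₁)) (s₂ : Equiv.Perm (Fin n₂))
    (i : Fin n₂) : blockPerm s₁ s₂ (Fin.natAdd n₁ i) = Fin.natAdd n₁ (s₂ i) := by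
  simp [blockPerm, Equiv.permCongr_apply]

theorem blockPerm_inv {n₁ n₂ : ℕ} (s₁ : Equiv.Perm (Fin n₁)) (s₂ : Equiv.Perm (Fin n₂)) :
    blockPerm s₁⁻¹ s₂⁻¹ = (blockPerm s₁ s₂)⁻¹ := by
  refine eq_inv_of_mul_eq_one_left (Equiv.ext fun j => ?_)
  refine Fin.addCases (fun i => ?_) (fun i => ?_) j <;> simp

/-- Shuffles represent the left cosets of the subgroup of block permutations: each coset has exactly
one member increasing on both blocks, found by sorting the values on each block. -/
theorem shuffle_mul_blockPerm_bijective (n₁ n₂ : ℕ) :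
    Function.Bijective fun p : Shuffle n₁ n₂ × Equiv.Perm (Fin n₁) × Equiv.Perm (Fin n₂) =>
      p.1.1 * blockPerm p.2.1 p.2.2 := by
  constructor
  · rintro ⟨ε, s₁, s₂⟩ ⟨ε', s₁', s₂'⟩ h
    have h : ε.1 * blockPerm s₁ s₂ = ε'.1 * blockPerm s₁' s₂' := h
    have h₁ : s₁ = s₁' := perm_eq_of_lt_imp fun i j hij => by
      have hi := DFunLike.congr_fun h (Fin.castAdd n₂ i)
      have hj := DFunLike.congr_fun h (Fin.castAdd n₂ j)
      simp only [Equiv.Perm.mul_apply, blockPerm_castAdd] at hi hj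
      refine ε.2.1.lt_iff_lt.1 ?_
      simp only [hi, hj]
      exact ε'.2.1 hij
    have h₂ : s₂ = s₂' := perm_eq_of_lt_imp fun i j hij => by
      have hi := DFunLike.congr_fun h (Fin.natAdd n₁ i)
      have hj := DFunLike.congr_fun h (Fin.natAdd n₁ j)
      simp only [Equiv.Perm.mul_apply, blockPerm_natAdd] at hi hj
      refine ε.2.2.lt_iff_lt.1 ?_
      simp only [hi, hj]
      exact ε'.2.2 hij
    subst h₁ h₂
    rw [Subtype.ext (mul_right_cancel h)]
  · intro ρ
    set s₁ := Tuple.sort fun i => ρ (Fin.castAdd n₂ i) with hs₁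
    set s₂ := Tuple.sort fun i => ρ (Fin.natAdd n₁ i) with hs₂
    have h : IsShuffle n₁ n₂ (ρ * blockPerm s₁ s₂) := by
      constructor
      · simp only [Equiv.Perm.mul_apply, blockPerm_castAdd]
        exact (Tuple.monotone_sort fun i => ρ (Fin.castAdd n₂ i)).strictMono_of_injective
          ((ρ.injective.comp (Fin.castAdd_injective n₁ n₂)).comp s₁.injective)
      · simp only [Equiv.Perm.mul_apply, blockPerm_natAdd]
        exact (Tuple.monotone_sort fun i => ρ (Fin.natAdd n₁ i)).strictMono_of_injective
          ((ρ.injective.comp (Fin.natAdd_injective n₂ n₁)).comp s₂.injective)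
    refine ⟨(⟨_, h⟩, s₁⁻¹, s₂⁻¹), ?_⟩
    simp [blockPerm_inv]

theorem blockPerm_mul_shuffle_inv_bijective (n₁ n₂ : ℕ) :
    Function.Bijective fun p : Shuffle n₁ n₂ × Equiv.Perm (Fin n₁) × Equiv.Perm (Fin n₂) =>
      blockPerm p.2.1 p.2.2 * p.1.1⁻¹ := by
  have h := (Equiv.inv (Equiv.Perm (Fin (n₁ + n₂)))).bijective.comp
    ((shuffle_mul_blockPerm_bijective n₁ n₂).comp
      (Equiv.prodCongr (Equiv.refl (Shuffle n₁ n₂))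
        (Equiv.prodCongr (Equiv.inv (Equiv.Perm (Fin n₁)))
          (Equiv.inv (Equiv.Perm (Fin n₂))))).bijective)
  convert h using 2 with p
  simp [blockPerm_inv]

/-! ### Shuffled products of forests -/

/-- The forest `T₁ ∧ T₂`, relabelled by a shuffle of the two blocks of vertices. -/
def shuffleWedge {n₁ n₂ : ℕ} (ε : Shuffle n₁ n₂) (T₁ : IncForest n₁) (T₂ : IncForest n₂) :
    IncForest (n₁ + n₂) where
  parent j := ((T₁.wedge T₂).parent (ε.1.symm j)).map ε.1
  parent_lt := by
    intro j i h
    obtain ⟨k, rfl⟩ := ε.1.surjective j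
    rw [Equiv.symm_apply_apply, Option.map_eq_some_iff] at h
    obtain ⟨a, ha, rfl⟩ := h
    revert ha
    refine Fin.addCases (fun k => ?_) (fun k => ?_) k
    · simp only [IncForest.wedge, Fin.addCases_left, Option.map_eq_some_iff]
      rintro ⟨b, hb, rfl⟩
      exact ε.2.1 (T₁.parent_lt k b hb)
    · simp only [IncForest.wedge, Fin.addCases_right, Option.map_eq_some_iff]
      rintro ⟨b, hb, rfl⟩
      exact ε.2.2 (T₂.parent_lt k b hb)

theorem isRelabelling_shuffleWedge {n₁ n₂ : ℕ} (ε : Shuffle n₁ n₂) (T₁ : IncForest n₁)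
    (T₂ : IncForest n₂) :
    IncForest.IsRelabelling ε.1 (T₁.wedge T₂) (shuffleWedge ε T₁ T₂) := fun j => by
  simp [shuffleWedge]

/-- The bilinear extension of `shuffleWedge`. -/
def shuffleWedgeGraph {n₁ n₂ : ℕ} (ε : Shuffle n₁ n₂) (x : IncForest n₁ →₀ ℝ)
    (y : IncForest n₂ →₀ ℝ) : IncForest (n₁ + n₂) →₀ ℝ :=
  x.sum fun T₁ a => y.sum fun T₂ b => Finsupp.single (shuffleWedge ε T₁ T₂) (a * b)

theorem indicatorForm_shuffleWedgeGraph {n₁ n₂ : ℕ} {β : Type*} [LinearOrder β]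
    (ε : Shuffle n₁ n₂) (x : IncForest n₁ →₀ ℝ) (y : IncForest n₂ →₀ ℝ)
    (z : Fin (n₁ + n₂) → β) :
    indicatorForm z (shuffleWedgeGraph ε x y) =
      indicatorForm (fun i => z (ε.1 (Fin.castAdd n₂ i))) x *
        indicatorForm (fun i => z (ε.1 (Fin.natAdd n₁ i))) y := by
  simp only [shuffleWedgeGraph, Finsupp.sum, map_sum, indicatorForm_single,
    (isRelabelling_shuffleWedge ε _ _).indicator_eq, indicator_wedge]
  simp only [indicatorForm, Finsupp.linearCombination_apply, Finsupp.sum, smul_eq_mul,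
    Finset.sum_mul_sum]
  exact Finset.sum_congr rfl fun T₁ _ => Finset.sum_congr rfl fun T₂ _ => by ring

/-- The shuffled product of two permutation graphs is a sum of permutation graphs. -/
theorem shuffleWedgeGraph_permGraph {n₁ n₂ : ℕ} (ε : Shuffle n₁ n₂) (σ₁ : Equiv.Perm (Fin n₁))
    (σ₂ : Equiv.Perm (Fin n₂)) :
    shuffleWedgeGraph ε (permGraph σ₁) (permGraph σ₂) =
      ∑ η : Shuffle n₁ n₂, permGraph (η.1 * blockPerm σ₁ σ₂ * ε.1⁻¹) := by
  classical
  refine indicatorMap_injective _ (funext fun π => ?_)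
  rw [map_sum]
  simp only [indicatorMap_permGraph, Finset.sum_apply, Pi.single_apply]
  change indicatorForm π _ = _
  rw [indicatorForm_shuffleWedgeGraph]
  -- The block parts `s₁`, `s₂` record the orders that `π` induces on the two relabelled blocks, so
  -- the left side tests `s₁ = σ₁` and `s₂ = σ₂`. On the right, uniqueness of the factorization
  -- leaves at most the term of `η`, under the same test.
  obtain ⟨⟨η, s₁, s₂⟩, h⟩ := (shuffle_mul_blockPerm_bijective n₁ n₂).2 (π * ε.1)
  have hη : ∀ i, π (ε.1 i) = η.1 (blockPerm s₁ s₂ i) := fun i => (DFunLike.congr_fun h i).symm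
  simp only [hη, blockPerm_castAdd, blockPerm_natAdd]
  have hinj₁ : Function.Injective fun i => η.1 (Fin.castAdd n₂ (s₁ i)) :=
    η.2.1.injective.comp s₁.injective
  have hinj₂ : Function.Injective fun i => η.1 (Fin.natAdd n₁ (s₂ i)) :=
    η.2.2.injective.comp s₂.injective
  rw [indicatorForm_permGraph _ hinj₁, indicatorForm_permGraph _ hinj₂]
  have h₁ : (∀ i j, σ₁ i < σ₁ j →
      η.1 (Fin.castAdd n₂ (s₁ i)) < η.1 (Fin.castAdd n₂ (s₁ j))) ↔ s₁ = σ₁ := by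
    constructor
    · exact fun H => perm_eq_of_lt_imp fun i j hij => η.2.1.lt_iff_lt.1 (H i j hij)
    · rintro rfl i j hij
      exact η.2.1 hij
  have h₂ : (∀ i j, σ₂ i < σ₂ j →
      η.1 (Fin.natAdd n₁ (s₂ i)) < η.1 (Fin.natAdd n₁ (s₂ j))) ↔ s₂ = σ₂ := by
    constructor
    · exact fun H => perm_eq_of_lt_imp fun i j hij => η.2.2.lt_iff_lt.1 (H i j hij)
    · rintro rfl i j hij
      exact η.2.2 hij
  have h₃ : ∀ η' : Shuffle n₁ n₂, π = η'.1 * blockPerm σ₁ σ₂ * ε.1⁻¹ ↔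
      η' = η ∧ s₁ = σ₁ ∧ s₂ = σ₂ := fun η' => by
    rw [eq_mul_inv_iff_mul_eq, ← h]
    constructor
    · intro H
      have := (shuffle_mul_blockPerm_bijective n₁ n₂).1
        (a₁ := (η, s₁, s₂)) (a₂ := (η', σ₁, σ₂)) H
      simp only [Prod.mk.injEq] at this
      exact ⟨this.1.symm, this.2⟩
    · rintro ⟨rfl, rfl, rfl⟩
      rfl
  simp only [h₁, h₂, h₃]
  by_cases hc₁ : s₁ = σ₁ <;> by_cases hc₂ : s₂ = σ₂ <;> simp [hc₁, hc₂]

/-! ### The sharp dyadic shells form a partition -/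

/-- Reflection reduces negative indices to positive ones. -/
theorem neg_mem_shell_neg {k : ℤ} {x : ℝ} : -x ∈ shell (-k) ↔ x ∈ shell k := by
  unfold shell
  rcases lt_trichotomy k 0 with hk | rfl | hk
  · simp only [neg_eq_zero, hk.ne, if_false, Left.neg_pos_iff, hk, if_true, not_lt.2 hk.le,
      Set.mem_Ioc, Set.mem_Ico]
    constructor <;> rintro ⟨h, h'⟩ <;> constructor <;> linarith
  · simp only [neg_zero, if_true, Set.mem_Icc]
    constructor <;> rintro ⟨h, h'⟩ <;> constructor <;> linarith
  · simp only [neg_eq_zero, hk.ne', if_false, Left.neg_pos_iff, hk, if_true, not_lt.2 hk.le,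
      Set.mem_Ioc, Set.mem_Ico, neg_neg]
    constructor <;> rintro ⟨h, h'⟩ <;> constructor <;> linarith

theorem mem_shell_of_pos {k : ℤ} (hk : 0 < k) {x : ℝ} :
    x ∈ shell k ↔ (2 : ℝ) ^ (k - 1) < x ∧ x ≤ (2 : ℝ) ^ k := by
  simp [shell, hk, hk.ne']

theorem one_lt_of_mem_shell {k : ℤ} (hk : 0 < k) {x : ℝ} (hx : x ∈ shell k) : 1 < x :=
  lt_of_le_of_lt (one_le_zpow₀ one_le_two (by omega)) ((mem_shell_of_pos hk).1 hx).1

theorem le_of_mem_shell {k l : ℤ} (hk : 0 < k) {x : ℝ} (hx : x ∈ shell k) (hl : 0 < l)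
    (hx' : x ∈ shell l) : k ≤ l := by
  by_contra! h
  have h1 := ((mem_shell_of_pos hk).1 hx).1
  have h2 := ((mem_shell_of_pos hl).1 hx').2
  have h3 : (2 : ℝ) ^ l ≤ 2 ^ (k - 1) := zpow_le_zpow_right₀ one_le_two (by omega)
  linarith

theorem shell_trichotomy {k : ℤ} {x : ℝ} (hx : x ∈ shell k) :
    (0 < k ∧ 1 < x) ∨ (k = 0 ∧ -1 ≤ x ∧ x ≤ 1) ∨ (k < 0 ∧ x < -1) := by
  rcases lt_trichotomy k 0 with hk | rfl | hk
  · have := one_lt_of_mem_shell (neg_pos.2 hk) (neg_mem_shell_neg.2 hx)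
    exact Or.inr (Or.inr ⟨hk, by linarith⟩)
  · exact Or.inr (Or.inl ⟨rfl, by simpa [shell] using hx⟩)
  · exact Or.inl ⟨hk, one_lt_of_mem_shell hk hx⟩

theorem shell_unique {k l : ℤ} {x : ℝ} (hx : x ∈ shell k) (hx' : x ∈ shell l) : k = l := by
  rcases shell_trichotomy hx with ⟨hk, h⟩ | ⟨hk, h⟩ | ⟨hk, h⟩ <;>
    rcases shell_trichotomy hx' with ⟨hl, h'⟩ | ⟨hl, h'⟩ | ⟨hl, h'⟩ <;> try linarith
  · exact le_antisymm (le_of_mem_shell hk hx hl hx') (le_of_mem_shell hl hx' hk hx)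
  · have hx := neg_mem_shell_neg.2 hx
    have hx' := neg_mem_shell_neg.2 hx'
    have h1 := le_of_mem_shell (neg_pos.2 hk) hx (neg_pos.2 hl) hx'
    have h2 := le_of_mem_shell (neg_pos.2 hl) hx' (neg_pos.2 hk) hx
    omega

theorem exists_mem_shell_of_one_lt {x : ℝ} (hx : 1 < x) : ∃ k, x ∈ shell k := by
  obtain ⟨m, hm, hm'⟩ := exists_mem_Ioc_zpow (zero_lt_one.trans hx) (one_lt_two (α := ℝ))
  have h : 0 < m + 1 := by
    by_contra! h
    have : (2 : ℝ) ^ (m + 1) ≤ 2 ^ (0 : ℤ) := zpow_le_zpow_right₀ one_le_two h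
    rw [zpow_zero] at this
    linarith
  exact ⟨m + 1, (mem_shell_of_pos h).2 ⟨by simpa using hm, hm'⟩⟩

theorem exists_mem_shell (x : ℝ) : ∃ k, x ∈ shell k := by
  by_cases h : 1 < x
  · exact exists_mem_shell_of_one_lt h
  by_cases h' : 1 < -x
  · obtain ⟨k, hk⟩ := exists_mem_shell_of_one_lt h'
    exact ⟨-k, by simpa using neg_mem_shell_neg.2 hk⟩
  · exact ⟨0, by simp only [shell, if_true, Set.mem_Icc]; constructor <;> linarith⟩

/-- The index of the shell of a real number. -/
def shellIndex (x : ℝ) : ℤ := (exists_mem_shell x).choose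

theorem phiTilde_eq (k : ℤ) (x : ℝ) : phiTilde k x = if k = shellIndex x then 1 else 0 := by
  have hx : x ∈ shell (shellIndex x) := (exists_mem_shell x).choose_spec
  unfold phiTilde
  split_ifs with h
  · rw [h, Set.indicator_of_mem hx, Pi.one_apply]
  · exact Set.indicator_of_notMem (fun hk => h (shell_unique hk hx)) _

-- The shells partition the line, so a single multi-index survives. What remains is counting
-- monotone rearrangements of integers.
open Classical in
theorem orderMultiplier_eq {n : ℕ} (τ : Equiv.Perm (Fin n)) (ξ : Fin n → ℝ) :
    orderMultiplier τ ξ = if Monotone (fun j => |shellIndex (ξ (τ j))|) then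
      (sigmaCard (fun v => shellIndex (ξ v)) : ℝ)⁻¹ else 0 := by
  unfold orderMultiplier
  rw [finsum_eq_single _ fun v => shellIndex (ξ v)]
  · simp [phiTilde_eq]
  · intro k hk
    obtain ⟨v, hv⟩ := Function.ne_iff.1 hk
    have : ∏ v, phiTilde (k v) (ξ v) = 0 :=
      Finset.prod_eq_zero (Finset.mem_univ v) (by rw [phiTilde_eq, if_neg hv])
    simp [this]

/-! ### Tensor products of projections -/

theorem sigmaCard_pos {n : ℕ} (k : Fin n → ℤ) : 0 < sigmaCard k :=
  have : Nonempty {τ : Equiv.Perm (Fin n) // ∀ j, |k (τ j)| = |k j|} := ⟨⟨1, fun _ => rfl⟩⟩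
  Nat.card_pos

/-- Right multiplication by a permutation sorting `|k|` carries the stabilizer of `|k|` onto the set
of all sorting permutations. -/
theorem card_monotone_eq_sigmaCard {n : ℕ} (k : Fin n → ℤ) :
    Nat.card {τ : Equiv.Perm (Fin n) // Monotone fun j => |k (τ j)|} = sigmaCard k := by
  set f : Fin n → ℤ := fun j => |k j|
  refine (Nat.card_congr (Equiv.subtypeEquiv (Equiv.mulRight (Tuple.sort f)) fun τ => ?_)).symm
  refine Iff.trans ?_ (Tuple.comp_sort_eq_comp_iff_monotone (f := f) (σ := τ * Tuple.sort f))
  constructor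
  · exact fun h => funext fun j => h _
  · intro h j
    simpa [f] using congrFun h ((Tuple.sort f).symm j)

theorem monotone_of_monotone_shuffle {n₁ n₂ : ℕ} {f : Fin (n₁ + n₂) → ℤ} (ε : Shuffle n₁ n₂)
    (h : Monotone fun j => f (ε.1⁻¹ j)) :
    Monotone (fun i => f (Fin.castAdd n₂ i)) ∧ Monotone fun i => f (Fin.natAdd n₁ i) :=
  ⟨by simpa [Function.comp_def] using h.comp ε.2.1.monotone, by simpa [Function.comp_def] using h.comp ε.2.2.monotone⟩

/-- A shuffle is increasing on each block, so monotonicity passes to the blocks. A finite sequence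
has only one monotone rearrangement; hence `s₁` and `s₂` preserve the values of `f`, and drop out.
-/
theorem monotone_blockPerm_mul_shuffle_inv_iff {n₁ n₂ : ℕ} {f : Fin (n₁ + n₂) → ℤ}
    (h₁ : Monotone fun i => f (Fin.castAdd n₂ i)) (h₂ : Monotone fun i => f (Fin.natAdd n₁ i))
    (ε : Shuffle n₁ n₂) (s₁ : Equiv.Perm (Fin n₁)) (s₂ : Equiv.Perm (Fin n₂)) :
    (Monotone fun j => f ((blockPerm s₁ s₂ * ε.1⁻¹) j)) ↔
      (Monotone fun j => f (ε.1⁻¹ j)) ∧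
        (∀ i, f (Fin.castAdd n₂ (s₁ i)) = f (Fin.castAdd n₂ i)) ∧
          ∀ i, f (Fin.natAdd n₁ (s₂ i)) = f (Fin.natAdd n₁ i) := by
  have key (H₁ : ∀ i, f (Fin.castAdd n₂ (s₁ i)) = f (Fin.castAdd n₂ i))
      (H₂ : ∀ i, f (Fin.natAdd n₁ (s₂ i)) = f (Fin.natAdd n₁ i)) :
      ∀ j, f (blockPerm s₁ s₂ j) = f j := fun j => by
    refine Fin.addCases (fun i => ?_) (fun i => ?_) j
    · rw [blockPerm_castAdd, H₁]
    · rw [blockPerm_natAdd, H₂]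
  constructor
  · intro h
    obtain ⟨m₁, m₂⟩ := monotone_of_monotone_shuffle (f := fun j => f (blockPerm s₁ s₂ j)) ε h
    simp only [blockPerm_castAdd, blockPerm_natAdd] at m₁ m₂
    have H₁ := Tuple.unique_monotone (f := fun i => f (Fin.castAdd n₂ i)) (σ := s₁) (τ := 1) m₁ h₁
    have H₂ := Tuple.unique_monotone (f := fun i => f (Fin.natAdd n₁ i)) (σ := s₂) (τ := 1) m₂ h₂
    have H₁ : ∀ i, f (Fin.castAdd n₂ (s₁ i)) = f (Fin.castAdd n₂ i) := congrFun H₁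
    have H₂ : ∀ i, f (Fin.natAdd n₁ (s₂ i)) = f (Fin.natAdd n₁ i) := congrFun H₂
    refine ⟨?_, H₁, H₂⟩
    simpa only [Equiv.Perm.mul_apply, key H₁ H₂] using h
  · rintro ⟨h, H₁, H₂⟩
    simpa only [Equiv.Perm.mul_apply, key H₁ H₂] using h

theorem sigmaCard_eq_mul {n₁ n₂ : ℕ} {k : Fin (n₁ + n₂) → ℤ}
    (h₁ : Monotone fun i => |k (Fin.castAdd n₂ i)|)
    (h₂ : Monotone fun i => |k (Fin.natAdd n₁ i)|) :
    sigmaCard k = Nat.card {ε : Shuffle n₁ n₂ // Monotone fun j => |k (ε.1⁻¹ j)|} *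
      (sigmaCard (fun i => k (Fin.castAdd n₂ i)) * sigmaCard fun i => k (Fin.natAdd n₁ i)) := by
  rw [← card_monotone_eq_sigmaCard, sigmaCard, sigmaCard, ← Nat.card_prod, ← Nat.card_prod]
  have e := Equiv.subtypeEquiv
    (p := fun p : Shuffle n₁ n₂ × Equiv.Perm (Fin n₁) × Equiv.Perm (Fin n₂) =>
      (Monotone fun j => |k (p.1.1⁻¹ j)|) ∧
        (∀ i, |k (Fin.castAdd n₂ (p.2.1 i))| = |k (Fin.castAdd n₂ i)|) ∧
          ∀ i, |k (Fin.natAdd n₁ (p.2.2 i))| = |k (Fin.natAdd n₁ i)|)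
    (q := fun τ : Equiv.Perm (Fin (n₁ + n₂)) => Monotone fun j => |k (τ j)|)
    (Equiv.ofBijective _ (blockPerm_mul_shuffle_inv_bijective n₁ n₂)) fun p =>
      (monotone_blockPerm_mul_shuffle_inv_iff (f := fun j => |k j|) h₁ h₂ p.1 p.2.1 p.2.2).symm
  refine (Nat.card_congr e).symm.trans (Nat.card_congr ?_)
  exact (Equiv.subtypeProdEquivProd
    (p := fun ε : Shuffle n₁ n₂ => Monotone fun j => |k (ε.1⁻¹ j)|)
    (q := fun s : Equiv.Perm (Fin n₁) × Equiv.Perm (Fin n₂) =>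
      (∀ i, |k (Fin.castAdd n₂ (s.1 i))| = |k (Fin.castAdd n₂ i)|) ∧
        ∀ i, |k (Fin.natAdd n₁ (s.2 i))| = |k (Fin.natAdd n₁ i)|)).trans
    (Equiv.prodCongr (Equiv.refl _) (Equiv.subtypeProdEquivProd
      (p := fun s : Equiv.Perm (Fin n₁) =>
        ∀ i, |k (Fin.castAdd n₂ (s i))| = |k (Fin.castAdd n₂ i)|)
      (q := fun s : Equiv.Perm (Fin n₂) =>
        ∀ i, |k (Fin.natAdd n₁ (s i))| = |k (Fin.natAdd n₁ i)|)))

/-- If both blocks are sorted, let N be the number of shuffles that sort the whole. By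
`sigmaCard_eq_mul`, `|Σ_k|` is N times the product of the two block counts, so N equal terms `1 /
|Σ_k|` give the left side. If a block is not sorted, no shuffle sorts the whole and both sides
vanish. -/
theorem orderMultiplier_one_mul {n₁ n₂ : ℕ} (ξ : Fin (n₁ + n₂) → ℝ) :
    orderMultiplier 1 (fun i => ξ (Fin.castAdd n₂ i)) *
        orderMultiplier 1 (fun i => ξ (Fin.natAdd n₁ i)) =
      ∑ ε : Shuffle n₁ n₂, orderMultiplier ε.1⁻¹ ξ := by
  classical
  simp only [orderMultiplier_eq, Equiv.Perm.coe_one, id]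
  set k : Fin (n₁ + n₂) → ℤ := fun v => shellIndex (ξ v) with hk
  change (if Monotone (fun i => |k (Fin.castAdd n₂ i)|) then
      (sigmaCard (fun i => k (Fin.castAdd n₂ i)) : ℝ)⁻¹ else 0) *
    (if Monotone (fun i => |k (Fin.natAdd n₁ i)|) then
      (sigmaCard (fun i => k (Fin.natAdd n₁ i)) : ℝ)⁻¹ else 0) =
    ∑ ε : Shuffle n₁ n₂, if Monotone (fun j => |k (ε.1⁻¹ j)|) then (sigmaCard k : ℝ)⁻¹ else 0
  by_cases h : Monotone (fun i => |k (Fin.castAdd n₂ i)|) ∧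
      Monotone fun i => |k (Fin.natAdd n₁ i)|
  · rw [if_pos h.1, if_pos h.2, ← Finset.sum_filter, Finset.sum_const, nsmul_eq_mul]
    have hc := sigmaCard_eq_mul h.1 h.2
    have hpos := sigmaCard_pos k
    rw [hc] at hpos ⊢
    have hN := Nat.pos_of_mul_pos_right hpos
    rw [Nat.card_eq_fintype_card, Fintype.card_subtype] at hN ⊢
    push_cast
    have hN' := (Nat.cast_ne_zero (R := ℝ)).2 hN.ne'
    rw [mul_inv, mul_inv, mul_inv_cancel_left₀ hN']
  · rw [Finset.sum_eq_zero]
    · rw [not_and_or] at h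
      rcases h with h | h <;> simp [h]
    · intro ε _
      exact if_neg fun hm => h (monotone_of_monotone_shuffle (f := fun j => |k j|) ε hm)

theorem tensor_pathMeasure {d n₁ n₂ : ℕ} (Γ : ℝ → EuclideanSpace ℝ (Fin d))
    (w₁ : Fin n₁ → Fin d) (w₂ : Fin n₂ → Fin d) :
    tensor (pathMeasure Γ w₁) (pathMeasure Γ w₂) = pathMeasure Γ (Fin.append w₁ w₂) := by
  funext ξ
  simp [tensor, pathMeasure, Fin.prod_univ_add]

theorem tensor_orderProj_one {n₁ n₂ : ℕ} (μ₁ : FourierSide n₁) (μ₂ : FourierSide n₂) :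
    tensor (orderProj 1 μ₁) (orderProj 1 μ₂) =
      ∑ ε : Shuffle n₁ n₂, orderProj ε.1⁻¹ (tensor μ₁ μ₂) := by
  funext ξ
  rw [Finset.sum_apply]
  simp only [tensor, orderProj]
  rw [← Finset.sum_mul, ← Complex.ofReal_sum, ← orderMultiplier_one_mul, Complex.ofReal_mul]
  ring

/-! ### The linear forms on formal combinations of forests -/

theorem orderProj_one_mem {d n : ℕ} (Γ : ℝ → EuclideanSpace ℝ (Fin d)) (T : IncForest n)
    (w : Fin n → Fin d) : orderProj 1 (pathMeasure Γ w) ∈ orderedMeasures Γ T :=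
  Submodule.subset_span ⟨1, w, fun j i h => T.parent_lt j i h, rfl⟩

/-- `T ↦ φ_{μ}(T)` for the component `μ` of `⊗_j dΓ(w(j))` attached to the natural ordering. -/
def graphForm {d n : ℕ} {Γ : ℝ → EuclideanSpace ℝ (Fin d)} (φ : FormFamily Γ)
    (w : Fin n → Fin d) : (IncForest n →₀ ℝ) →ₗ[ℝ] ℝ :=
  Finsupp.linearCombination ℝ fun T => φ n T ⟨_, orderProj_one_mem Γ T w⟩

theorem formOnGraph_eq {d n : ℕ} {Γ : ℝ → EuclideanSpace ℝ (Fin d)} (φ : FormFamily Γ)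
    (w : Fin n → Fin d) (σ : Equiv.Perm (Fin n)) :
    formOnGraph φ w σ = graphForm φ (fun j => w (σ j)) (permGraph σ) := by
  unfold formOnGraph graphForm
  rw [Finsupp.linearCombination_apply]
  simp only [splitMeasure_pathMeasure, smul_eq_mul]

theorem graphForm_single {d n : ℕ} {Γ : ℝ → EuclideanSpace ℝ (Fin d)} (φ : FormFamily Γ)
    (w : Fin n → Fin d) (T : IncForest n) (a : ℝ) :
    graphForm φ w (Finsupp.single T a) = a * φ n T ⟨_, orderProj_one_mem Γ T w⟩ := by
  simp [graphForm]

theorem compatibleOrder_wedge {n₁ n₂ : ℕ} (ε : Shuffle n₁ n₂) (T₁ : IncForest n₁)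
    (T₂ : IncForest n₂) : CompatibleOrder (T₁.wedge T₂) ε.1⁻¹ := by
  intro j i h
  refine (shuffleWedge ε T₁ T₂).parent_lt (ε.1 j) (ε.1 i) ?_
  rw [isRelabelling_shuffleWedge, h, Option.map_some]

theorem lt_iff_lt_of_sameTree_wedge {n₁ n₂ : ℕ} {T₁ : IncForest n₁} {T₂ : IncForest n₂}
    {i j : Fin (n₁ + n₂)} (h : (T₁.wedge T₂).SameTree i j) :
    i.val < n₁ ↔ j.val < n₁ := by
  induction h with
  | rel j i h =>
    revert h
    refine Fin.addCases (fun k => ?_) (fun k => ?_) j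
    · simp only [IncForest.wedge, Fin.addCases_left, Option.map_eq_some_iff]
      rintro ⟨b, _, rfl⟩
      simp
    · simp only [IncForest.wedge, Fin.addCases_right, Option.map_eq_some_iff]
      rintro ⟨b, _, rfl⟩
      simp
  | refl => rfl
  | symm _ _ _ ih => exact ih.symm
  | trans _ _ _ _ _ ih₁ ih₂ => exact ih₁.trans ih₂

/-- Every tree of the product lies in one block, where a shuffle is increasing. This makes
relabelling invariance applicable to `ε`. -/
theorem shuffle_lt_of_sameTree {n₁ n₂ : ℕ} (ε : Shuffle n₁ n₂) {T₁ : IncForest n₁}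
    {T₂ : IncForest n₂} (i j : Fin (n₁ + n₂)) (h : (T₁.wedge T₂).SameTree i j) (hij : i < j) :
    ε.1 i < ε.1 j := by
  have hb := lt_iff_lt_of_sameTree_wedge h
  clear h
  revert hb hij
  refine Fin.addCases (fun a => ?_) (fun a => ?_) i <;>
    refine Fin.addCases (fun b => ?_) (fun b => ?_) j <;> intro hij hb
  · exact ε.2.1 hij
  · simp at hb
  · simp at hb
  · exact ε.2.2 (by simpa using hij)

/-- Each ordered piece of the tensor product lies in the domain for `T₁.wedge T₂`, since `ε⁻¹` is
compatible with that forest. Linearity separates the pieces, and relabelling by `ε` brings each back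
to the natural order, with the letters permuted. -/
theorem form_mul_form {d n₁ n₂ : ℕ} {Γ : ℝ → EuclideanSpace ℝ (Fin d)} {φ : FormFamily Γ}
    (hmul : IsHMultiplicative φ) (hrel : IsRelabellingInvariant φ) (h₁ : 1 ≤ n₁) (h₂ : 1 ≤ n₂)
    (w₁ : Fin n₁ → Fin d) (w₂ : Fin n₂ → Fin d) (T₁ : IncForest n₁) (T₂ : IncForest n₂) :
    φ n₁ T₁ ⟨_, orderProj_one_mem Γ T₁ w₁⟩ * φ n₂ T₂ ⟨_, orderProj_one_mem Γ T₂ w₂⟩ =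
      ∑ ε : Shuffle n₁ n₂, φ (n₁ + n₂) (shuffleWedge ε T₁ T₂)
        ⟨_, orderProj_one_mem Γ _ fun j => Fin.append w₁ w₂ (ε.1⁻¹ j)⟩ := by
  have hmem (ε : Shuffle n₁ n₂) :
      orderProj ε.1⁻¹ (pathMeasure Γ (Fin.append w₁ w₂)) ∈ orderedMeasures Γ (T₁.wedge T₂) :=
    Submodule.subset_span ⟨ε.1⁻¹, _, compatibleOrder_wedge ε T₁ T₂, rfl⟩
  rw [hmul n₁ n₂ h₁ h₂ T₁ T₂ _ _ (∑ ε : Shuffle n₁ n₂, ⟨_, hmem ε⟩), map_sum]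
  · refine Finset.sum_congr rfl fun ε _ => ?_
    refine (hrel _ _ _ ε.1 (isRelabelling_shuffleWedge ε T₁ T₂) (shuffle_lt_of_sameTree ε)
      _ _ ?_).symm
    exact (splitMeasure_pathMeasure Γ ε.1⁻¹ (Fin.append w₁ w₂)).symm
  · rw [tensor_orderProj_one, tensor_pathMeasure]
    simp

theorem graphForm_mul_graphForm {d n₁ n₂ : ℕ} {Γ : ℝ → EuclideanSpace ℝ (Fin d)}
    {φ : FormFamily Γ} (hmul : IsHMultiplicative φ) (hrel : IsRelabellingInvariant φ)
    (h₁ : 1 ≤ n₁) (h₂ : 1 ≤ n₂) (w₁ : Fin n₁ → Fin d) (w₂ : Fin n₂ → Fin d)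
    (x : IncForest n₁ →₀ ℝ) (y : IncForest n₂ →₀ ℝ) :
    graphForm φ w₁ x * graphForm φ w₂ y =
      ∑ ε : Shuffle n₁ n₂, graphForm φ (fun j => Fin.append w₁ w₂ (ε.1⁻¹ j))
        (shuffleWedgeGraph ε x y) := by
  have hR (ε : Shuffle n₁ n₂) := fun w => show graphForm φ w (shuffleWedgeGraph ε x y) =
      ∑ T₁ ∈ x.support, ∑ T₂ ∈ y.support, x T₁ * y T₂ *
        φ _ (shuffleWedge ε T₁ T₂) ⟨_, orderProj_one_mem Γ _ w⟩ by
    simp only [shuffleWedgeGraph, Finsupp.sum, map_sum, graphForm_single]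
  simp only [hR]
  rw [Finset.sum_comm]
  simp_rw [graphForm, Finsupp.linearCombination_apply, Finsupp.sum, Finset.sum_mul_sum]
  refine Finset.sum_congr rfl fun T₁ _ => ?_
  rw [Finset.sum_comm]
  refine Finset.sum_congr rfl fun T₂ _ => ?_
  rw [← Finset.mul_sum, ← form_mul_form hmul hrel h₁ h₂]
  simp only [smul_eq_mul]
  ring

/-! ### Multiplicativity on words -/

theorem sum_formOnGraph_mul {d n₁ n₂ : ℕ} {Γ : ℝ → EuclideanSpace ℝ (Fin d)}
    {φ : FormFamily Γ} (hmul : IsHMultiplicative φ) (hrel : IsRelabellingInvariant φ)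
    (h₁ : 1 ≤ n₁) (h₂ : 1 ≤ n₂) (w₁ : Fin n₁ → Fin d) (w₂ : Fin n₂ → Fin d) :
    (∑ σ, formOnGraph φ w₁ σ) * ∑ σ, formOnGraph φ w₂ σ =
      ∑ η : Shuffle n₁ n₂, ∑ σ, formOnGraph φ (fun j => Fin.append w₁ w₂ (η.1.symm j)) σ := by
  have happ (σ₁ : Equiv.Perm (Fin n₁)) (σ₂ : Equiv.Perm (Fin n₂)) :
      Fin.append (fun j => w₁ (σ₁ j)) (fun j => w₂ (σ₂ j)) =
        fun j => Fin.append w₁ w₂ (blockPerm σ₁ σ₂ j) := by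
    funext j
    refine Fin.addCases (fun i => ?_) (fun i => ?_) j <;> simp
  have hR (η : Shuffle n₁ n₂) :
      ∑ σ, formOnGraph φ (fun j => Fin.append w₁ w₂ (η.1.symm j)) σ =
        ∑ ρ, graphForm φ (fun j => Fin.append w₁ w₂ (ρ j)) (permGraph (η.1 * ρ)) := by
    -- Putting `σ = η * ρ` cancels `η.symm` in the word, which then depends on `ρ` alone.
    rw [← Equiv.sum_comp (Equiv.mulLeft η.1)]
    refine Finset.sum_congr rfl fun ρ _ => ?_
    simp [formOnGraph_eq]
  simp only [hR]
  rw [Finset.sum_comm,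
    ← (blockPerm_mul_shuffle_inv_bijective n₁ n₂).sum_comp fun ρ =>
      ∑ η : Shuffle n₁ n₂, graphForm φ (fun j => Fin.append w₁ w₂ (ρ j)) (permGraph (η.1 * ρ)),
    Fintype.sum_prod_type, Finset.sum_comm, Fintype.sum_prod_type, Finset.sum_mul_sum]
  refine Finset.sum_congr rfl fun σ₁ _ => Finset.sum_congr rfl fun σ₂ _ => ?_
  rw [formOnGraph_eq, formOnGraph_eq, graphForm_mul_graphForm hmul hrel h₁ h₂]
  refine Finset.sum_congr rfl fun ε _ => ?_
  simp only [shuffleWedgeGraph_permGraph, map_sum, happ, Equiv.Perm.mul_apply, ← mul_assoc]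

theorem chiBar_single {d : ℕ} {Γ : ℝ → EuclideanSpace ℝ (Fin d)} (φ : FormFamily Γ) (u : Word d)
    (a : ℝ) : chiBar φ (Finsupp.single u a) = a * chiBarWord φ u := by
  simp [chiBar]

theorem chiBar_shuffleWords_eq_sum {d : ℕ} {Γ : ℝ → EuclideanSpace ℝ (Fin d)} (φ : FormFamily Γ)
    (u v : Word d) : chiBar φ (shuffleWords u v) = ∑ ε : Shuffle u.1 v.1,
      chiBarWord φ ⟨u.1 + v.1, fun j => Fin.append u.2 v.2 (ε.1.symm j)⟩ := by
  classical
  unfold shuffleWords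
  rw [map_sum]
  simp only [chiBar_single, one_mul]
  exact Finset.sum_subtype _ (by simp) _

theorem shuffle_eq_one_of_left_empty {n : ℕ} (ε : Shuffle 0 n) : ε.1 = 1 := by
  have h (j : Fin (0 + n)) : ∃ i : Fin n, j = Fin.natAdd 0 i :=
    Fin.addCases (fun i => i.elim0) (fun i => ⟨i, rfl⟩) j
  refine perm_eq_one_of_strictMono fun a b hab => ?_
  obtain ⟨i, rfl⟩ := h a
  obtain ⟨j, rfl⟩ := h b
  exact ε.2.2 (by simpa using hab)

theorem shuffle_eq_one_of_right_empty {n : ℕ} (ε : Shuffle n 0) : ε.1 = 1 :=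
  perm_eq_one_of_strictMono ε.2.1

theorem isShuffle_one (n₁ n₂ : ℕ) : IsShuffle n₁ n₂ 1 :=
  ⟨fun _ _ h => h, fun _ _ h => by simpa using h⟩

/-- For the case of an empty factor, treated apart because multiplicativity of the forms is only
assumed for nonempty forests. -/
theorem chiBar_shuffleWords_of_unique {d : ℕ} {Γ : ℝ → EuclideanSpace ℝ (Fin d)}
    (φ : FormFamily Γ) (u v : Word d) (h : ∀ ε : Shuffle u.1 v.1, ε.1 = 1) :
    chiBar φ (shuffleWords u v) = chiBarWord φ ⟨u.1 + v.1, Fin.append u.2 v.2⟩ := by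
  rw [chiBar_shuffleWords_eq_sum, Fintype.sum_eq_single ⟨1, isShuffle_one _ _⟩]
  · rfl
  · exact fun ε hε => absurd (Subtype.ext (h ε)) hε

/-- Needed because `0 + n` and `n` index different function types. -/
theorem word_ext {d n m : ℕ} (h : n = m) (w : Fin n → Fin d) (w' : Fin m → Fin d)
    (hw : ∀ i, w i = w' (Fin.cast h i)) : (⟨n, w⟩ : Word d) = ⟨m, w'⟩ := by
  subst h
  exact congrArg (Sigma.mk n) (funext hw)

theorem chiBar_shuffleWords {d : ℕ} {Γ : ℝ → EuclideanSpace ℝ (Fin d)} {φ : FormFamily Γ}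
    (hmul : IsHMultiplicative φ) (hrel : IsRelabellingInvariant φ) (u v : Word d) :
    chiBar φ (shuffleWords u v) = chiBarWord φ u * chiBarWord φ v := by
  obtain ⟨n₁, u⟩ := u
  obtain ⟨n₂, v⟩ := v
  rcases Nat.eq_zero_or_pos n₁ with rfl | h₁
  · rw [chiBar_shuffleWords_of_unique φ _ _ shuffle_eq_one_of_left_empty,
      word_ext (Nat.zero_add n₂) _ v]
    · simp [chiBarWord]
    · refine Fin.addCases (fun i => i.elim0) fun i => ?_
      rw [Fin.append_right]
      exact Fin.ext (by simp)
  rcases Nat.eq_zero_or_pos n₂ with rfl | h₂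
  · rw [chiBar_shuffleWords_of_unique φ _ _ shuffle_eq_one_of_right_empty,
      word_ext (Nat.add_zero n₁) _ u]
    · simp [chiBarWord]
    · exact Fin.addCases (fun i => Fin.append_left _ _ i) fun i => i.elim0
  rw [chiBar_shuffleWords_eq_sum]
  simp only [chiBarWord, h₁.ne', h₂.ne', (Nat.add_pos_left h₁ n₂).ne', if_false]
  exact (sum_formOnGraph_mul hmul hrel h₁ h₂ u v).symm

theorem chiBar_shuffle {d : ℕ} {Γ : ℝ → EuclideanSpace ℝ (Fin d)} {φ : FormFamily Γ}
    (hmul : IsHMultiplicative φ) (hrel : IsRelabellingInvariant φ) (x y : Sh d) :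
    chiBar φ (shuffle x y) = chiBar φ x * chiBar φ y := by
  unfold shuffle
  simp only [Finsupp.sum, map_sum, map_smul, chiBar_shuffleWords hmul hrel]
  simp only [chiBar, Finsupp.linearCombination_apply, Finsupp.sum, Finset.sum_mul_sum,
    smul_eq_mul]
  exact Finset.sum_congr rfl fun u _ => Finset.sum_congr rfl fun v _ => by ring

end FourierNormalOrdering

end

theorem lemma3p5 {d : ℕ} (α : ℝ≥0) (hα₀ : 0 < α) (hα₁ : α < 1)
    (Γ : ℝ → EuclideanSpace ℝ (Fin d)) (hΓ_supp : HasCompactSupport Γ)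
    (hΓ : ∃ C : ℝ≥0, HolderWith C α Γ)
    (φ : ℝ → FourierNormalOrdering.FormFamily Γ)
    (hmul : ∀ t, FourierNormalOrdering.IsHMultiplicative (φ t))
    (hrel : ∀ t, FourierNormalOrdering.IsRelabellingInvariant (φ t)) (t : ℝ) :
    FourierNormalOrdering.IsCharacter (FourierNormalOrdering.chiBar (φ t)) := by
  refine ⟨?_, FourierNormalOrdering.chiBar_shuffle (hmul t) (hrel t)⟩
  simp [FourierNormalOrdering.shUnit, FourierNormalOrdering.chiBar_single,
    FourierNormalOrdering.chiBarWord]
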